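/- A continuous map $p:(\widetilde X,\tilde x_0)\to(X,x_0)$ has the \emph{unique lifting property} if for every connected, locally path connected space $(Y,y_0)$ and every continuous map $f:(Y,y_0)\to(X,x_0)$ with $f_*\pi_1(Y,y_0)\subseteq p_*\pi_1(\widetilde X,\tilde x_0)$ there is a unique continuous map $\tilde f:(Y,y_0)\to(\widetilde X,\tilde x_0)$ with $p\circ\tilde f=f$. If moreover $\widetilde X$ is connected and locally path connected, then $(\widetilde X,p)$ is called a \emph{generalized covering space} of $X$. A \emph{generalized covering group} of a topological group $G$ is a pair $(\widetilde G,p)$ consisting of a topological group $\widetilde G$ and a continuous homomorphism $p:(\widetilde G,\tilde e)\to(G,e)$, where $\tilde e,e$ are the identity elements, such that $(\widetilde G,p)$ is a generalized covering space of $G$. \textbf{Corollary.} If $G$ is a connected, locally path connected topological group and $(\widetilde G,p)$ is a generalized covering group of $G$, then $p:\widetilde G\to G$ is a (Hurewicz) fibration; that is, for every topological space $Y$ and all continuous maps $f:Y\to\widetilde G$ and $H:Y\times[0,1]\to G$ with $H(y,0)=p(f(y))$ for all $y\in Y$, there is a continuous map $K:Y\times[0,1]\to\widetilde G$ with $K(y,0)=f(y)$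 for all $y\in Y$ and $p\circ K=H$. -/

import Mathlib

open scoped unitInterval

universe u v w

/-- A continuous map `p : (E, e₀) → (X, p e₀)` of pointed spaces has the *unique lifting property*
if for every connected, locally path connected pointed space `(Y, y₀)` and every continuous
`f : (Y, y₀) → (X, p e₀)` with `f_* π₁(Y, y₀) ≤ p_* π₁(E, e₀)` there is exactly one continuous
`g : (Y, y₀) → (E, e₀)` with `p ∘ g = f`. -/
def HasUniqueLiftingProperty {E : Type u} {X : Type v} [TopologicalSpace E] [TopologicalSpace X]
    (p : C(E, X)) (e₀ : E) : Prop :=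
  ∀ (Y : Type (max u v)) [TopologicalSpace Y] [ConnectedSpace Y] [LocallyPathConnectedSpace Y]
    (y₀ : Y) (f : C(Y, X)) (hf : f y₀ = p e₀),
    (FundamentalGroup.mapOfEq f hf).range ≤ (FundamentalGroup.map p e₀).range →
      ∃! g : C(Y, E), g y₀ = e₀ ∧ p.comp g = f

/-- `p : (E, e₀) → (X, p e₀)` is a *generalized covering map* (and `(E, p)` is a generalized
covering space of `X`) if `E` is connected and locally path connected and `p` has the unique
lifting property. -/
structure IsGeneralizedCovering {E : Type u} {X : Type v} [TopologicalSpace E]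
    [TopologicalSpace X] (p : C(E, X)) (e₀ : E) : Prop where
  connected : ConnectedSpace E
  locPathConnected : LocallyPathConnectedSpace E
  uniqueLifting : HasUniqueLiftingProperty p e₀

/-- A *generalized covering group* of a topological group `G`: a topological group `G'` with a
continuous homomorphism `p : G' → G` such that `p : (G', 1) → (G, 1)` is a generalized covering. -/
def IsGeneralizedCoveringGroup {G' : Type u} {G : Type v} [Group G'] [TopologicalSpace G']
    [IsTopologicalGroup G'] [Group G] [TopologicalSpace G] [IsTopologicalGroup G]
    (p : G' →ₜ* G) : Prop :=
  IsGeneralizedCovering (p : C(G', G)) 1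

/-- `p : E → B` is a *(Hurewicz) fibration*: it has the homotopy lifting property with respect to
every topological space `Y` (in an arbitrary universe `w`). -/
def IsHurewiczFibration {E : Type u} {B : Type v} [TopologicalSpace E] [TopologicalSpace B]
    (p : C(E, B)) : Prop :=
  ∀ (Y : Type w) [TopologicalSpace Y] (f : C(Y, E)) (H : C(Y × I, B)),
    (∀ y, H (y, 0) = p (f y)) →
      ∃ K : C(Y × I, E), (∀ y, K (y, 0) = f y) ∧ p.comp K = H

/-!
Let `P` be the group of paths in `G` starting at `1`. Rescaling `γ ↦ γ (s * ·)` contracts `P` to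
its identity element, which therefore has arbitrarily small neighborhoods stable under rescaling,
hence path connected; by translation `P` is locally path connected. As `P` is also simply
connected, the unique lifting property lifts the endpoint map `P → G` to a map `L : P → G'` with
`L 1 = 1`. For a homotopy `H` starting at `p ∘ f`, the initial segment of length `t` of the path
`H (y, 0)⁻¹ * H (y, ·)`, stretched to `I`, is an element `γ y t` of `P`, and
`(y, t) ↦ f y * L (γ y t)` lifts `H`.
-/

open Topology

section UnitIntervalAction

variable {X : Type*} [TopologicalSpace X] [MulAction I X] [ContinuousSMul I X] {x₀ : X}

theorem contractibleSpace_of_zero_smul (zero_smul : ∀ x : X, (0 : I) • x = x₀) :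
    ContractibleSpace X := by
  let contraction : (ContinuousMap.const X x₀).Homotopy (ContinuousMap.id X) :=
    { toFun := fun z ↦ z.1 • z.2
      map_zero_left := zero_smul
      map_one_left := one_smul I }
  exact (contractible_iff_id_nullhomotopic X).mpr ⟨x₀, ⟨contraction.symm⟩⟩

theorem setOf_forall_smul_mem_mem_nhds (zero_smul : ∀ x : X, (0 : I) • x = x₀) {W : Set X}
    (hW : W ∈ 𝓝 x₀) : {x : X | ∀ s : I, s • x ∈ W} ∈ 𝓝 x₀ := by
  have smul_base (s : I) : s • x₀ = x₀ := by
    rw [← zero_smul x₀, smul_smul, mul_zero]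
  have near_base (s : I) : ∀ᶠ z : X × I in 𝓝 (x₀, s), z.2 • z.1 ∈ W :=
    (continuous_snd.smul continuous_fst).continuousAt.eventually_mem
      (show W ∈ 𝓝 (s • x₀) by rwa [smul_base])
  filter_upwards [isCompact_univ.eventually_forall_of_forall_eventually
    (P := fun x (s : I) ↦ s • x ∈ W) fun s _ ↦ near_base s] with x hx s
  exact hx s (Set.mem_univ s)

theorem isPathConnected_setOf_forall_smul_mem (zero_smul : ∀ x : X, (0 : I) • x = x₀) {W : Set X}
    (hW : W ∈ 𝓝 x₀) : IsPathConnected {x : X | ∀ s : I, s • x ∈ W} := by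
  refine ⟨x₀, mem_of_mem_nhds (setOf_forall_smul_mem_mem_nhds zero_smul hW), fun {x} hx ↦ ?_⟩
  let radialPath : Path x₀ x :=
    { toFun := fun t ↦ t • x
      source' := zero_smul x
      target' := one_smul I x }
  refine ⟨radialPath, fun t s ↦ ?_⟩
  change s • t • x ∈ W
  rw [smul_smul]
  exact hx (s * t)

theorem nhds_hasBasis_isPathConnected_of_zero_smul (zero_smul : ∀ x : X, (0 : I) • x = x₀) :
    (𝓝 x₀).HasBasis (fun S ↦ S ∈ 𝓝 x₀ ∧ IsPathConnected S) id :=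
  Filter.hasBasis_self.mpr fun W hW ↦
    ⟨{x | ∀ s : I, s • x ∈ W}, setOf_forall_smul_mem_mem_nhds zero_smul hW,
      isPathConnected_setOf_forall_smul_mem zero_smul hW,
      fun x hx ↦ one_smul I x ▸ hx 1⟩

end UnitIntervalAction

theorem locallyPathConnectedSpace_of_nhds_one_hasBasis {P : Type*} [Group P] [TopologicalSpace P]
    [SeparatelyContinuousMul P]
    (basis_one : (𝓝 (1 : P)).HasBasis (fun S ↦ S ∈ 𝓝 1 ∧ IsPathConnected S) id) :
    LocallyPathConnectedSpace P where
  path_connected_basis x := by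
    refine Filter.hasBasis_self.mpr fun W hW ↦ ?_
    have nhds_eq : 𝓝 x = (𝓝 1).map (x * ·) := by
      simpa only [Homeomorph.coe_mulLeft, mul_one] using
        ((Homeomorph.mulLeft x).map_nhds_eq 1).symm
    rw [nhds_eq] at hW ⊢
    obtain ⟨S, ⟨hS, S_conn⟩, hSW⟩ := basis_one.mem_iff.mp hW
    exact ⟨(x * ·) '' S, Filter.image_mem_map hS, S_conn.image (continuous_const_mul x),
      Set.image_subset_iff.mpr hSW⟩

/-- The group of continuous paths in `G` starting at `1`, with pointwise multiplication and the
compact-open topology. -/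
def basedPaths (G : Type*) [Group G] [TopologicalSpace G] [IsTopologicalGroup G] :
    Subgroup C(I, G) where
  carrier := {γ | γ 0 = 1}
  mul_mem' {γ δ} (hγ : γ 0 = 1) (hδ : δ 0 = 1) := by
    simp only [Set.mem_ofPred_eq, ContinuousMap.mul_apply, hγ, hδ, mul_one]
  one_mem' := rfl
  inv_mem' {γ} (hγ : γ 0 = 1) := by
    simp only [Set.mem_ofPred_eq, ContinuousMap.inv_apply, hγ, inv_one]

namespace basedPaths

variable {G : Type*} [Group G] [TopologicalSpace G] [IsTopologicalGroup G]

/-- The rescaling action: `s • γ` is the initial segment of `γ` of length `s`, stretched to `I`. -/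
instance : MulAction I (basedPaths G) where
  smul s γ := ⟨⟨fun t ↦ γ.1 (s * t), by fun_prop⟩, (congrArg γ.1 (mul_zero s)).trans γ.2⟩
  one_smul γ := Subtype.ext <| ContinuousMap.ext fun t ↦ congrArg γ.1 (one_mul t)
  mul_smul s s' γ := Subtype.ext <| ContinuousMap.ext fun t ↦ congrArg γ.1 <|
    (congrArg (· * t) (mul_comm s s')).trans (mul_assoc s' s t)

theorem smul_apply (s : I) (γ : basedPaths G) (t : I) : (s • γ).1 t = γ.1 (s * t) := rfl

theorem zero_smul (γ : basedPaths G) : (0 : I) • γ = 1 :=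
  Subtype.ext <| ContinuousMap.ext fun t ↦ (congrArg γ.1 (zero_mul t)).trans γ.2

instance : ContinuousMul (basedPaths G) :=
  (basedPaths G).toSubmonoid.continuousMul

instance : ContinuousSMul I (basedPaths G) where
  continuous_smul := by
    refine Continuous.subtype_mk (ContinuousMap.continuous_of_continuous_uncurry _ ?_) _
    change Continuous fun z : (I × basedPaths G) × I ↦ z.1.2.1 (z.1.1 * z.2)
    fun_prop

instance : ContractibleSpace (basedPaths G) :=
  contractibleSpace_of_zero_smul zero_smul

instance : LocallyPathConnectedSpace (basedPaths G) :=
  locallyPathConnectedSpace_of_nhds_one_hasBasis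
    (nhds_hasBasis_isPathConnected_of_zero_smul zero_smul)

/-- The map sending a path starting at `1` to its endpoint. -/
def endpoint : C(basedPaths G, G) where
  toFun γ := γ.1 1

theorem endpoint_one : endpoint (1 : basedPaths G) = 1 := rfl

theorem endpoint_smul (s : I) (γ : basedPaths G) : endpoint (s • γ) = γ.1 s := by
  change (s • γ).1 1 = γ.1 s
  rw [smul_apply, mul_one]

/-- The family of tracks of a homotopy `H`, each translated so as to start at `1`. -/
def ofHomotopy {Y : Type*} [TopologicalSpace Y] (H : C(Y × I, G)) : C(Y, basedPaths G) where
  toFun y := ⟨⟨fun t ↦ (H (y, 0))⁻¹ * H (y, t), by fun_prop⟩, inv_mul_cancel (H (y, 0))⟩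
  continuous_toFun := by
    refine Continuous.subtype_mk (ContinuousMap.continuous_of_continuous_uncurry _ ?_) _
    change Continuous fun z : Y × I ↦ (H (z.1, 0))⁻¹ * H z
    fun_prop

theorem ofHomotopy_apply {Y : Type*} [TopologicalSpace Y] (H : C(Y × I, G)) (y : Y) (t : I) :
    (ofHomotopy H y).1 t = (H (y, 0))⁻¹ * H (y, t) := rfl

end basedPaths

theorem HasUniqueLiftingProperty.exists_lift_of_simplyConnectedSpace {E : Type u} {X : Type v}
    [TopologicalSpace E] [TopologicalSpace X] {p : C(E, X)} {e₀ : E}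
    (hp : HasUniqueLiftingProperty p e₀) {Z : Type w} [Small.{max u v} Z] [TopologicalSpace Z]
    [SimplyConnectedSpace Z] [LocallyPathConnectedSpace Z] (z₀ : Z) (f : C(Z, X))
    (hf : f z₀ = p e₀) : ∃ g : C(Z, E), g z₀ = e₀ ∧ p.comp g = f := by
  let h : Z ≃ₜ Shrink.{max u v} Z := Shrink.homeomorph Z
  have : SimplyConnectedSpace (Shrink.{max u v} Z) := h.symm.toHomotopyEquiv.simplyConnectedSpace
  have : LocallyPathConnectedSpace (Shrink.{max u v} Z) :=
    h.symm.isOpenEmbedding.locallyPathConnectedSpace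
  have map_base : f.comp (h.symm : C(Shrink.{max u v} Z, Z)) (h z₀) = p e₀ := by
    simpa using hf
  have range_le : (FundamentalGroup.mapOfEq _ map_base).range ≤
      (FundamentalGroup.map p e₀).range := by
    rintro _ ⟨a, rfl⟩
    rw [Subsingleton.elim a 1, map_one]
    exact one_mem _
  obtain ⟨g, ⟨hg₀, hg⟩, -⟩ := hp _ (h z₀) _ map_base range_le
  refine ⟨g.comp h, hg₀, ContinuousMap.ext fun z ↦ ?_⟩
  simpa using DFunLike.congr_fun hg (h z)

section Fibration

variable {G : Type v} {G' : Type u} [Group G] [TopologicalSpace G] [IsTopologicalGroup G]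
  [Monoid G'] [TopologicalSpace G'] [ContinuousMul G']

theorem isHurewiczFibration_of_endpoint_lift (p : G' →ₜ* G) (L : C(basedPaths G, G'))
    (L_one : L 1 = 1) (hL : (p : C(G', G)).comp L = basedPaths.endpoint) :
    IsHurewiczFibration.{u, v, w} (p : C(G', G)) := by
  intro Y _ f H hH
  let γ : C(Y, basedPaths G) := basedPaths.ofHomotopy H
  have p_lift (y : Y) (t : I) : p (L (t • γ y)) = (H (y, 0))⁻¹ * H (y, t) := calc
    p (L (t • γ y)) = basedPaths.endpoint (t • γ y) := DFunLike.congr_fun hL (t • γ y)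
    _ = (γ y).1 t := basedPaths.endpoint_smul t (γ y)
    _ = (H (y, 0))⁻¹ * H (y, t) := basedPaths.ofHomotopy_apply H y t
  let K : C(Y × I, G') := ⟨fun z ↦ f z.1 * L (z.2 • γ z.1), by fun_prop⟩
  refine ⟨K, fun y ↦ ?_, ContinuousMap.ext fun ⟨y, t⟩ ↦ ?_⟩
  · change f y * L ((0 : I) • γ y) = f y
    rw [basedPaths.zero_smul, L_one, mul_one]
  · have p_start : p (f y) = H (y, 0) := (hH y).symm
    change p (f y * L (t • γ y)) = H (y, t)
    rw [map_mul, p_lift, p_start, mul_inv_cancel_left]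

theorem mainTheorem9_general (p : G' →ₜ* G) (hp : HasUniqueLiftingProperty (p : C(G', G)) 1) :
    IsHurewiczFibration.{u, v, w} (p : C(G', G)) := by
  have : Small.{max u v} (basedPaths G) := small_max.{u} _
  have endpoint_base : basedPaths.endpoint (1 : basedPaths G) = (p : C(G', G)) 1 :=
    basedPaths.endpoint_one.trans (map_one p).symm
  obtain ⟨L, L_one, hL⟩ :=
    hp.exists_lift_of_simplyConnectedSpace 1 basedPaths.endpoint endpoint_base
  exact isHurewiczFibration_of_endpoint_lift p L L_one hL

end Fibration

theorem mainTheorem9 {G : Type v} {G' : Type u} [Group G] [TopologicalSpace G]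
    [IsTopologicalGroup G] [ConnectedSpace G] [LocallyPathConnectedSpace G]
    [Group G'] [TopologicalSpace G'] [IsTopologicalGroup G'] (p : G' →ₜ* G)
    (hp : IsGeneralizedCoveringGroup p) :
    IsHurewiczFibration.{u, v, w} (p : C(G', G)) :=
  mainTheorem9_general p hp.uniqueLifting
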